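/- A finite simple graph $G$ is \emph{$P_4$-sparse} if every set of five vertices of $G$ contains at most one $4$-element subset inducing a chordless path $P_4$. The \emph{lexicographic product} $G[H]$ has vertex set $V(G)\times V(H)$, with $(x,y)$ adjacent to $(x',y')$ if and only if either $x=x'$ and $yy'\in E(H)$, or $xx'\in E(G)$. A \emph{b-coloring} of a graph with $k$ colors is a proper coloring with $k$ color classes, each of which contains a vertex having a neighbor in every other color class. The \emph{b-chromatic number} $\chi_b$ is the largest $k$ for which the graph has a b-coloring with $k$ colors, and a graph is \emph{b-continuous} if it has a b-coloring with $k$ colors for every integer $k$ between its chromatic number $\chi$ and $\chi_b$, both included. Theorem. If $G$ is a finite $P_4$-sparse graph and $\ell$ is any positive integer, then $G[K_\ell]$ is b-continuous, where $K_\ell$ is the complete graph on $\ell$ vertices. That is, $G[K_\ell]$ has a b-coloring with $k$ colors for every integer $k\in[\chi(G[K_\ell]),\chi_b(G[K_\ell])]$. -/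

import Mathlib

namespace SimpleGraph

/-- The vertex set `t` induces a `P₄` (a chordless path on four vertices) in `G`. -/
def InducesP4 {V : Type*} (G : SimpleGraph V) (t : Finset V) : Prop :=
  Nonempty (pathGraph 4 ≃g G.induce (t : Set V))

/-- `G` is `P₄`-sparse: every set of five vertices induces at most one `P₄`. -/
def IsP4Sparse {V : Type*} (G : SimpleGraph V) : Prop :=
  ∀ s : Finset V, s.card = 5 → ∀ t₁ t₂ : Finset V, t₁ ⊆ s → t₂ ⊆ s →
    G.InducesP4 t₁ → G.InducesP4 t₂ → t₁ = t₂

/-- The lexicographic product `G[H]`. -/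
def lexProduct {V W : Type*} (G : SimpleGraph V) (H : SimpleGraph W) :
    SimpleGraph (V × W) where
  Adj p q := (p.1 = q.1 ∧ H.Adj p.2 q.2) ∨ G.Adj p.1 q.1
  symm := ⟨fun _ _ h => h.imp (fun h' => ⟨h'.1.symm, h'.2.symm⟩) (fun h' => h'.symm)⟩
  loopless := ⟨fun _ h => h.elim (fun h' => H.irrefl h'.2) (fun h' => G.irrefl h')⟩

/-- `v` is a b-vertex (of its own color) in the proper coloring `c`: it has a neighbor in every
other color class. -/
def Coloring.IsBVertex {V α : Type*} {G : SimpleGraph V} (c : G.Coloring α) (v : V) : Prop :=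
  ∀ j : α, j ≠ c v → ∃ w : V, G.Adj v w ∧ c w = j

/-- `c` is a b-coloring: every color has a b-vertex (in particular every color is used). -/
def Coloring.IsBColoring {V α : Type*} {G : SimpleGraph V} (c : G.Coloring α) : Prop :=
  ∀ i : α, ∃ v : V, c v = i ∧ c.IsBVertex v

/-- `G` has a b-coloring with (exactly) `k` colors. -/
def HasBColoring {V : Type*} (G : SimpleGraph V) (k : ℕ) : Prop :=
  ∃ c : G.Coloring (Fin k), c.IsBColoring

/-- The b-chromatic number `χ_b(G)`: the largest `k` such that `G` has a b-coloring with `k`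
colors. For a finite graph the maximum exists, see `isGreatest_bChromaticNumber`. -/
noncomputable def bChromaticNumber {V : Type*} (G : SimpleGraph V) : ℕ :=
  sSup {k : ℕ | G.HasBColoring k}

/-- `G` is b-continuous: it has a b-coloring with `k` colors for every integer `k` in
`[χ(G), χ_b(G)]`. -/
def IsBContinuous {V : Type*} (G : SimpleGraph V) : Prop :=
  ∀ k : ℕ, G.chromaticNumber ≤ k → k ≤ G.bChromaticNumber → G.HasBColoring k

/-- On a finite graph the supremum defining `χ_b` is attained. -/
theorem isGreatest_bChromaticNumber {V : Type*} [Finite V] (G : SimpleGraph V) :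
    IsGreatest {k : ℕ | G.HasBColoring k} G.bChromaticNumber := by
  classical
  have hbdd : BddAbove {k : ℕ | G.HasBColoring k} := by
    refine ⟨Nat.card V, ?_⟩
    rintro k ⟨c, hc⟩
    have hs : Function.Surjective c := fun i => (hc i).imp fun v hv => hv.1
    simpa using Nat.card_le_card_of_surjective c hs
  have hex : ∃ k, G.Colorable k := by
    cases nonempty_fintype V
    exact ⟨_, G.colorable_of_fintype⟩
  have hne : {k : ℕ | G.HasBColoring k}.Nonempty := by
    refine ⟨Nat.find hex, ?_⟩
    obtain ⟨c⟩ := Nat.find_spec hex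
    refine ⟨c, fun i => ?_⟩
    by_contra hcon
    have h : ∀ v, c v = i → ∃ j, j ≠ i ∧ ∀ w, G.Adj v w → c w ≠ j := by
      intro v hv
      by_contra h2
      refine hcon ⟨v, hv, fun j hj => ?_⟩
      by_contra h3
      exact h2 ⟨j, hv ▸ hj, fun w hw hcw => h3 ⟨w, hw, hcw⟩⟩
    choose f hf using h
    let d : G.Coloring {j : Fin (Nat.find hex) // j ≠ i} := Coloring.mk
      (fun v => if hv : c v = i then ⟨f v hv, (hf v hv).1⟩ else ⟨c v, hv⟩) (by
        intro v w hvw heq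
        by_cases hv : c v = i <;> by_cases hw : c w = i <;>
          simp only [hv, hw, dif_pos, dif_neg, not_false_eq_true, Subtype.mk.injEq] at heq
        · exact c.valid hvw (hv.trans hw.symm)
        · exact (hf v hv).2 w hvw heq.symm
        · exact (hf w hw).2 v hvw.symm heq
        · exact c.valid hvw heq)
    have hcol := d.colorable
    have hcard : Fintype.card {j : Fin (Nat.find hex) // j ≠ i} < Nat.find hex := by
      have := Fintype.card_subtype_lt (p := fun j => j ≠ i) (x := i) (by simp)
      simpa only [Fintype.card_fin] using this
    exact Nat.find_min hex hcard hcol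
  exact ⟨Nat.sSup_mem hne hbdd, fun k hk => le_csSup hbdd hk⟩

end SimpleGraph

/-! A coloring of `G[K_ℓ]` amounts to giving each vertex of `G` a set of `ℓ` colors, disjoint along
edges. It is a b-coloring when every color lies on a vertex whose closed neighborhood shows all
colors. It suffices to descend from such a coloring with `m + 1` colors to one with `m`, whenever
any multicoloring with `m` colors exists (`DescendsOn`); iterating from `χ_b` reaches every `k ≥ χ`.

The descent is an induction over induced subgraphs, driven by a structure theorem
(`ExtendsP4.hasCut_or_exists_isSpiderPartition`): with at least two vertices, the graph is
disconnected, co-disconnected, or a spider with independent legs `S`, clique `K` and a rest. In a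
disjoint union, each color is dominated inside one part, and the dominated colors of the two parts
can be renamed independently to cover the smaller palette. In a join the palettes are disjoint, and
one side has a color to spare. In a spider, the legs see too few colors to dominate, so they can be
deleted, the remainder descended, and the legs recolored greedily. -/

namespace SimpleGraph

/-! ### Structure of `P₄`-sparse graphs. -/

section Structure

variable {V : Type*} {G : SimpleGraph V}

/-- `a, b, c, d` induce, in this order, a chordless path on four vertices. -/
structure IsInducedPath4 (G : SimpleGraph V) (a b c d : V) : Prop where
  ab : G.Adj a b
  bc : G.Adj b c
  cd : G.Adj c d
  ac : ¬ G.Adj a c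
  ad : ¬ G.Adj a d
  bd : ¬ G.Adj b d

theorem IsInducedPath4.ne_ac {a b c d : V} (h : G.IsInducedPath4 a b c d) : a ≠ c := by
  rintro rfl; exact h.ad h.cd

theorem IsInducedPath4.ne_ad {a b c d : V} (h : G.IsInducedPath4 a b c d) : a ≠ d := by
  rintro rfl; exact h.bd h.ab.symm

theorem IsInducedPath4.ne_bd {a b c d : V} (h : G.IsInducedPath4 a b c d) : b ≠ d := by
  rintro rfl; exact h.ad h.ab

theorem IsInducedPath4.inducesP4 [DecidableEq V] {a b c d : V} (h : G.IsInducedPath4 a b c d) :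
    G.InducesP4 {a, b, c, d} := by
  have hab := h.ab.ne
  have hbc := h.bc.ne
  have hcd := h.cd.ne
  have hac := h.ne_ac
  have had := h.ne_ad
  have hbd := h.ne_bd
  let f : Fin 4 → (({a, b, c, d} : Finset V) : Set V) :=
    ![⟨a, by simp⟩, ⟨b, by simp⟩, ⟨c, by simp⟩, ⟨d, by simp⟩]
  have hf : Function.Bijective f := by
    constructor
    · intro i j hij
      fin_cases i <;> fin_cases j <;> simp_all [f, Subtype.ext_iff]
    · rintro ⟨v, hv⟩
      simp only [Finset.coe_insert, Finset.coe_singleton, Set.mem_insert_iff,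
        Set.mem_singleton_iff] at hv
      rcases hv with rfl | rfl | rfl | rfl
      exacts [⟨0, rfl⟩, ⟨1, rfl⟩, ⟨2, rfl⟩, ⟨3, rfl⟩]
  refine ⟨⟨Equiv.ofBijective f hf, ?_⟩⟩
  intro i j
  have h1 := h.ab
  have h2 := h.bc
  have h3 := h.cd
  have h4 := h.ac
  have h5 := h.ad
  have h6 := h.bd
  fin_cases i <;> fin_cases j <;>
    simp [f, pathGraph_adj, h1, h2, h3, h4, h5, h6, h1.symm, h2.symm, h3.symm,
      G.adj_comm c a, G.adj_comm d a, G.adj_comm d b]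

/-- A vertex outside an induced `P₄` sees none of it, all of it, or exactly its midpoints. -/
def ExtendsP4 (G : SimpleGraph V) : Prop :=
  ∀ a b c d x, G.IsInducedPath4 a b c d → x ≠ a → x ≠ b → x ≠ c → x ≠ d →
    (G.Adj x a ↔ G.Adj x d) ∧ (G.Adj x b ↔ G.Adj x c) ∧ (G.Adj x a → G.Adj x b)

/-- Any other adjacency pattern of `x` creates an induced `P₄` through `x` on the same five
vertices, a second one next to `a, b, c, d`. The eight paths `k1`, ..., `k8`, paired by reversing
`a, b, c, d`, cover all the bad patterns. -/
theorem IsP4Sparse.extendsP4 (hG : G.IsP4Sparse) : G.ExtendsP4 := by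
  classical
  intro a b c d x h xa xb xc xd
  have key : ∀ p q r s, G.IsInducedPath4 p q r s → x ∈ ({p, q, r, s} : Finset V) →
      ({p, q, r, s} : Finset V) ⊆ {a, b, c, d, x} → False := by
    intro p q r s h' hx hsub
    have hcard : ({a, b, c, d, x} : Finset V).card = 5 := by
      have hab := h.ab.ne
      have hbc := h.bc.ne
      have hcd := h.cd.ne
      have hac := h.ne_ac
      have had := h.ne_ad
      have hbd := h.ne_bd
      rw [Finset.card_insert_of_notMem, Finset.card_insert_of_notMem,
        Finset.card_insert_of_notMem, Finset.card_insert_of_notMem, Finset.card_singleton] <;>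
        simp [*, xa.symm, xb.symm, xc.symm, xd.symm]
    have heq := hG _ hcard {a, b, c, d} {p, q, r, s}
      (by intro v; simp only [Finset.mem_insert, Finset.mem_singleton]; tauto) hsub
      h.inducesP4 h'.inducesP4
    rw [← heq] at hx
    simp [xa, xb, xc, xd] at hx
  have key' : ∀ p q r s, G.IsInducedPath4 p q r s →
      (x = p ∨ x = q ∨ x = r ∨ x = s) → (p = a ∨ p = b ∨ p = c ∨ p = d ∨ p = x) →
      (q = a ∨ q = b ∨ q = c ∨ q = d ∨ q = x) → (r = a ∨ r = b ∨ r = c ∨ r = d ∨ r = x) →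
      (s = a ∨ s = b ∨ s = c ∨ s = d ∨ s = x) → False := by
    intro p q r s h' hx hp hq hr hs
    refine key p q r s h' (by simpa using hx) ?_
    intro v hv
    simp only [Finset.mem_insert, Finset.mem_singleton] at hv ⊢
    rcases hv with rfl | rfl | rfl | rfl <;> assumption
  obtain ⟨h1, h2, h3, h4, h5, h6⟩ := h
  have k1 : ¬ G.IsInducedPath4 x a b c := fun h =>
    key' _ _ _ _ h (by simp) (by simp) (by simp) (by simp) (by simp)
  have k2 : ¬ G.IsInducedPath4 x d c b := fun h =>
    key' _ _ _ _ h (by simp) (by simp) (by simp) (by simp) (by simp)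
  have k3 : ¬ G.IsInducedPath4 x b c d := fun h =>
    key' _ _ _ _ h (by simp) (by simp) (by simp) (by simp) (by simp)
  have k4 : ¬ G.IsInducedPath4 x c b a := fun h =>
    key' _ _ _ _ h (by simp) (by simp) (by simp) (by simp) (by simp)
  have k5 : ¬ G.IsInducedPath4 a x c d := fun h =>
    key' _ _ _ _ h (by simp) (by simp) (by simp) (by simp) (by simp)
  have k6 : ¬ G.IsInducedPath4 d x b a := fun h =>
    key' _ _ _ _ h (by simp) (by simp) (by simp) (by simp) (by simp)
  have k7 : ¬ G.IsInducedPath4 a x d c := fun h =>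
    key' _ _ _ _ h (by simp) (by simp) (by simp) (by simp) (by simp)
  have k8 : ¬ G.IsInducedPath4 d x a b := fun h =>
    key' _ _ _ _ h (by simp) (by simp) (by simp) (by simp) (by simp)
  have e : ∀ p q r s, G.IsInducedPath4 p q r s ↔
      (G.Adj p q ∧ G.Adj q r ∧ G.Adj r s ∧ ¬ G.Adj p r ∧ ¬ G.Adj p s ∧ ¬ G.Adj q s) :=
    fun p q r s => ⟨fun ⟨a, b, c, d, e, f⟩ => ⟨a, b, c, d, e, f⟩,
      fun ⟨a, b, c, d, e, f⟩ => ⟨a, b, c, d, e, f⟩⟩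
  simp only [e, G.adj_comm a x, G.adj_comm d x, G.adj_comm d c, G.adj_comm c b, G.adj_comm b a,
    G.adj_comm d b, G.adj_comm c a, G.adj_comm d a, h1, h2, h3, h4, h5, h6]
    at k1 k2 k3 k4 k5 k6 k7 k8
  clear key key' e hG
  grind

theorem ExtendsP4.induce (hG : G.ExtendsP4) (X : Set V) : (G.induce X).ExtendsP4 := by
  intro a b c d x h xa xb xc xd
  obtain ⟨h1, h2, h3, h4, h5, h6⟩ := h
  exact hG a b c d x ⟨h1, h2, h3, h4, h5, h6⟩ (fun h => xa (Subtype.ext h))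
    (fun h => xb (Subtype.ext h)) (fun h => xc (Subtype.ext h)) (fun h => xd (Subtype.ext h))

/-- The graph or its complement is disconnected. -/
def HasCut (G : SimpleGraph V) : Prop :=
  ∃ X : Set V, X.Nonempty ∧ Xᶜ.Nonempty ∧
    ((∀ x ∈ X, ∀ y ∉ X, ¬ G.Adj x y) ∨ ∀ x ∈ X, ∀ y ∉ X, G.Adj x y)

/-- If a module `B` contains no single vertex of an induced `P₄` and the graph is connected and
co-connected, then some induced `P₄` has its midpoints complete and its ends anticomplete
to `B`. -/
theorem hasCut_or_exists_isInducedPath4_of_module [Finite V] {B : Set V} (hB : B.Nonempty)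
    (hBc : Bᶜ.Nonempty)
    (hmod : ∀ x ∉ B, (∀ b ∈ B, G.Adj x b) ∨ ∀ b ∈ B, ¬ G.Adj x b)
    (hend : ∀ b ∈ B, ∀ a ∉ B, ∀ n ∉ B, ∀ n' ∉ B, ¬ G.IsInducedPath4 b a n n')
    (hmid : ∀ b ∈ B, ∀ n ∉ B, ∀ a ∉ B, ∀ a' ∉ B, ¬ G.IsInducedPath4 n a b a') :
    G.HasCut ∨ ∃ n₁ a₁ a₂ n₂, G.IsInducedPath4 n₁ a₁ a₂ n₂ ∧
      ∀ b ∈ B, ¬ G.Adj n₁ b ∧ G.Adj a₁ b ∧ G.Adj a₂ b ∧ ¬ G.Adj n₂ b := by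
  by_contra! hcon
  obtain ⟨hcut, hP⟩ := hcon
  obtain ⟨b₀, hb₀⟩ := hB
  have hedge : ∀ X : Set V, X.Nonempty → Xᶜ.Nonempty → ∃ x ∈ X, ∃ y ∉ X, G.Adj x y := by
    intro X h1 h2
    by_contra! h3
    exact hcut ⟨X, h1, h2, Or.inl h3⟩
  have hnonedge : ∀ X : Set V, X.Nonempty → Xᶜ.Nonempty → ∃ x ∈ X, ∃ y ∉ X, ¬ G.Adj x y := by
    intro X h1 h2
    by_contra! h3
    exact hcut ⟨X, h1, h2, Or.inr h3⟩
  -- Since `B` is a module, `A` (complete to `B`) and `N` (anticomplete to `B`) exhaust the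
  -- complement of `B`.
  let A : Set V := {x | x ∉ B ∧ ∀ b ∈ B, G.Adj x b}
  let N : Set V := {x | x ∉ B ∧ ∀ b ∈ B, ¬ G.Adj x b}
  have hAN : ∀ x, x ∈ B ∨ x ∈ A ∨ x ∈ N := by
    intro x
    by_cases hx : x ∈ B
    · exact Or.inl hx
    · exact Or.inr ((hmod x hx).imp (fun h => ⟨hx, h⟩) (fun h => ⟨hx, h⟩))
  have F1 : ∀ a ∈ A, ∀ n ∈ N, ∀ n' ∈ N, G.Adj a n → G.Adj n n' → G.Adj a n' := by
    intro a ha n hn n' hn' h1 h2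
    by_contra h3
    exact hend b₀ hb₀ a ha.1 n hn.1 n' hn'.1 ⟨(ha.2 _ hb₀).symm, h1, h2,
      fun h => hn.2 _ hb₀ h.symm, fun h => hn'.2 _ hb₀ h.symm, h3⟩
  have F2 : ∀ a ∈ A, ∀ a' ∈ A, ∀ n ∈ N, ¬ G.Adj a a' → G.Adj a n → G.Adj a' n := by
    intro a ha a' ha' n hn h1 h2
    by_contra h3
    exact hmid b₀ hb₀ n hn.1 a ha.1 a' ha'.1 ⟨h2.symm, ha.2 _ hb₀, (ha'.2 _ hb₀).symm,
      hn.2 _ hb₀, fun h => h3 h.symm, h1⟩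
  -- The neighborhoods in `N` of vertices of `A` form a chain: otherwise `F2` gives `a₁ ~ a₂`, `F1`
  -- gives `n₁ ≁ n₂`, and `n₁ a₁ a₂ n₂` is the excluded path.
  have F3 : ∀ a₁ ∈ A, ∀ a₂ ∈ A, ∀ n₁ ∈ N, ∀ n₂ ∈ N, G.Adj a₁ n₁ → G.Adj a₂ n₂ →
      ¬ G.Adj a₂ n₁ → G.Adj a₁ n₂ := by
    intro a₁ ha₁ a₂ ha₂ n₁ hn₁ n₂ hn₂ h1 h2 h3
    by_contra h4
    obtain ⟨b, hb, hb'⟩ := hP n₁ a₁ a₂ n₂ ⟨h1.symm, by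
        by_contra h5
        exact h3 (F2 _ ha₁ _ ha₂ _ hn₁ h5 h1), h2, fun h => h3 h.symm,
        fun h => h4 (F1 _ ha₁ _ hn₁ _ hn₂ h1 h), h4⟩
    exact hn₂.2 b hb (hb' (hn₁.2 b hb) (ha₁.2 b hb) (ha₂.2 b hb))
  have hA : A.Nonempty := by
    obtain ⟨b, hb, y, hy, hby⟩ := hedge B ⟨b₀, hb₀⟩ hBc
    rcases hAN y with h | h | h
    · exact (hy h).elim
    · exact ⟨y, h⟩
    · exact (h.2 b hb hby.symm).elim
  obtain ⟨a, ha, hmax⟩ := Set.exists_max_image A (fun a => (N ∩ {n | G.Adj a n}).ncard)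
    A.toFinite hA
  -- By connectedness an edge leaves the set of vertices of `N` missed by `a`. Its other end is
  -- either in `A`, with a strictly larger neighborhood by `F3`, or a neighbor of `a` in `N`,
  -- against `F1`.
  have hfull : ∀ n ∈ N, G.Adj a n := by
    by_contra! hne
    obtain ⟨n, hn, han⟩ := hne
    obtain ⟨x, hx, y, hy, hxy⟩ := hedge {n | n ∈ N ∧ ¬ G.Adj a n} ⟨n, hn, han⟩
      ⟨b₀, fun h => h.1.1 hb₀⟩
    rcases hAN y with h | h | h
    · exact hx.1.2 y h hxy
    · refine (hmax y h).not_gt (Set.ncard_lt_ncard ?_ (Set.toFinite _))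
      refine ⟨fun m hm => ⟨hm.1, ?_⟩, fun hsub => hx.2 (hsub ⟨hx.1, hxy.symm⟩).2⟩
      by_contra hym
      exact hx.2 (F3 a ha y h m hm.1 x hx.1 hm.2 hxy.symm hym)
    · have hay : G.Adj a y := by
        by_contra hay
        exact hy ⟨h, hay⟩
      exact hx.2 (F1 a ha y h x hx.1 hay hxy.symm)
  -- The vertices complete to both `B` and `N` are complete to everything else: by `F2`, a vertex of
  -- `A` missed by one of them is itself complete to `N`. This contradicts co-connectedness.
  obtain ⟨x, hx, y, hy, hxy⟩ := hnonedge {a | a ∈ A ∧ ∀ n ∈ N, G.Adj a n} ⟨a, ha, hfull⟩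
    ⟨b₀, fun h => h.1.1 hb₀⟩
  rcases hAN y with h | h | h
  · exact hxy (hx.1.2 y h)
  · exact hy ⟨h, fun n hn => F2 x hx.1 y h n hn hxy (hx.2 n hn)⟩
  · exact hxy (hx.2 y h)

/-! ### Spider cores and the decomposition theorem. -/

/-- A clique `K` and an independent set `S`, linked so that every other vertex sees all of
`S ∪ K`, none of it, or exactly `K`. -/
structure IsSpiderCore (G : SimpleGraph V) (S K : Set V) : Prop where
  indep : ∀ s ∈ S, ∀ s' ∈ S, ¬ G.Adj s s'
  clique : ∀ k ∈ K, ∀ k' ∈ K, k ≠ k' → G.Adj k k'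
  disj : ∀ v ∈ S, v ∉ K
  homog : ∀ x ∉ S, x ∉ K → ∃ P Q : Prop, (P → Q) ∧ (∀ s ∈ S, (G.Adj x s ↔ P)) ∧
    ∀ k ∈ K, (G.Adj x k ↔ Q)
  nonadj : ∀ s ∈ S, ∃ k ∈ K, ¬ G.Adj s k
  edge : ∃ s ∈ S, ∃ k ∈ K, G.Adj s k

/-- The core together with the vertices that see exactly the clique. -/
def spiderBody (G : SimpleGraph V) (S K : Set V) : Set V :=
  {x | x ∈ S ∨ x ∈ K ∨ ((∀ s ∈ S, ¬ G.Adj x s) ∧ ∀ k ∈ K, G.Adj x k)}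

theorem IsInducedPath4.isSpiderCore (hG : G.ExtendsP4) {a b c d : V}
    (h : G.IsInducedPath4 a b c d) : G.IsSpiderCore {a, d} {b, c} where
  indep := by
    rintro s (rfl | rfl) s' (rfl | rfl)
    exacts [G.irrefl, h.ad, fun h' => h.ad h'.symm, G.irrefl]
  clique := by
    rintro s (rfl | rfl) s' (rfl | rfl) hne
    exacts [(hne rfl).elim, h.bc, h.bc.symm, (hne rfl).elim]
  disj := by
    rintro s (rfl | rfl) (h' | h')
    exacts [h.ab.ne h', h.ne_ac h', h.ne_bd h'.symm, h.cd.ne' h']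
  homog := by
    intro x hx hx'
    simp only [Set.mem_insert_iff, Set.mem_singleton_iff, not_or] at hx hx'
    obtain ⟨h1, h2, h3⟩ := hG a b c d x h hx.1 hx'.1 hx'.2 hx.2
    refine ⟨G.Adj x a, G.Adj x b, h3, ?_, ?_⟩
    · rintro s (rfl | rfl)
      exacts [Iff.rfl, h1.symm]
    · rintro s (rfl | rfl)
      exacts [Iff.rfl, h2.symm]
  nonadj := by
    rintro s (rfl | rfl)
    exacts [⟨c, by simp, h.ac⟩, ⟨b, by simp, fun h' => h.bd h'.symm⟩]
  edge := ⟨a, by simp, b, by simp, h.ab⟩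

/-- A core grows by a chordless path `s, k', k, s'` (or its reversal) with `s, k` in the core. -/
theorem IsSpiderCore.insert (hG : G.ExtendsP4) {S K : Set V} (h : G.IsSpiderCore S K) {p q : V}
    (hpK : p ∉ K) (hqS : q ∉ S) (hpS : ∀ s ∈ S, ¬ G.Adj p s) (hqK : ∀ k ∈ K, q ≠ k → G.Adj q k)
    (hpq : p ≠ q) (hp : ∃ k ∈ Insert.insert q K, ¬ G.Adj p k)
    (hpath : ∃ s ∈ S, ∃ k ∈ K, G.IsInducedPath4 s q k p ∨ G.IsInducedPath4 s k q p) :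
    G.IsSpiderCore (Insert.insert p S) (Insert.insert q K) ∧
      G.spiderBody S K ⊆ G.spiderBody (Insert.insert p S) (Insert.insert q K) := by
  obtain ⟨s, hs, k, hk, hP⟩ := hpath
  -- On the path, `s` and `p` are the ends and `q` and `k` the midpoints, so `x` treats `p` like `s`
  -- and `q` like `k`.
  have hext : ∀ x, x ∉ Insert.insert p S → x ∉ Insert.insert q K →
      (G.Adj x p ↔ G.Adj x s) ∧ (G.Adj x q ↔ G.Adj x k) := by
    intro x hx hx'
    simp only [Set.mem_insert_iff, not_or] at hx hx'
    have hxs : x ≠ s := fun e => hx.2 (e ▸ hs)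
    have hxk : x ≠ k := fun e => hx'.2 (e ▸ hk)
    rcases hP with hP | hP
    · obtain ⟨h1, h2, -⟩ := hG _ _ _ _ x hP hxs hx'.1 hxk hx.1
      exact ⟨h1.symm, h2⟩
    · obtain ⟨h1, h2, -⟩ := hG _ _ _ _ x hP hxs hxk hx'.1 hx.1
      exact ⟨h1.symm, h2.symm⟩
  refine ⟨⟨?_, ?_, ?_, ?_, ?_, ?_⟩, ?_⟩
  · rintro u (rfl | hu) w (rfl | hw)
    exacts [G.irrefl, hpS w hw, fun h' => hpS u hu h'.symm, h.indep u hu w hw]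
  · rintro u (rfl | hu) w (rfl | hw) hne
    exacts [(hne rfl).elim, hqK w hw hne, (hqK u hu hne.symm).symm, h.clique u hu w hw hne]
  · rintro u (rfl | hu) (h' | h')
    exacts [hpq h', hpK h', hqS (h' ▸ hu), h.disj u hu h']
  · intro x hx hx'
    obtain ⟨h1, h2⟩ := hext x hx hx'
    obtain ⟨P, Q, hPQ, hSx, hKx⟩ := h.homog x (fun h' => hx (Or.inr h')) (fun h' => hx' (Or.inr h'))
    refine ⟨P, Q, hPQ, ?_, ?_⟩
    · rintro u (rfl | hu)
      exacts [h1.trans (hSx s hs), hSx u hu]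
    · rintro u (rfl | hu)
      exacts [h2.trans (hKx k hk), hKx u hu]
  · rintro u (rfl | hu)
    · exact hp
    · obtain ⟨k', hk', h'⟩ := h.nonadj u hu
      exact ⟨k', Or.inr hk', h'⟩
  · obtain ⟨s', hs', k', hk', h'⟩ := h.edge
    exact ⟨s', Or.inr hs', k', Or.inr hk', h'⟩
  · intro x hx
    by_cases h1 : x ∈ Insert.insert p S
    · exact Or.inl h1
    by_cases h2 : x ∈ Insert.insert q K
    · exact Or.inr (Or.inl h2)
    rcases hx with hx | hx | hx
    · exact (h1 (Or.inr hx)).elim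
    · exact (h2 (Or.inr hx)).elim
    · obtain ⟨e1, e2⟩ := hext x h1 h2
      refine Or.inr (Or.inr ⟨?_, ?_⟩)
      · rintro u (rfl | hu)
        exacts [fun h' => hx.1 s hs (e1.1 h'), hx.1 u hu]
      · rintro u (rfl | hu)
        exacts [e2.2 (hx.2 k hk), hx.2 u hu]

/-- A partition of the vertices into a nonempty independent set `S`, a clique `K` and a rest that
is complete to `K` and anticomplete to `S`, where no vertex of `S` is complete to `K`. -/
structure IsSpiderPartition (G : SimpleGraph V) (S K : Set V) : Prop where
  nonempty : S.Nonempty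
  indep : ∀ s ∈ S, ∀ s' ∈ S, ¬ G.Adj s s'
  clique : ∀ k ∈ K, ∀ k' ∈ K, k ≠ k' → G.Adj k k'
  disj : ∀ v ∈ S, v ∉ K
  nonadj : ∀ s ∈ S, ∃ k ∈ K, ¬ G.Adj s k
  rest : ∀ x ∉ S, x ∉ K → (∀ s ∈ S, ¬ G.Adj x s) ∧ ∀ k ∈ K, G.Adj x k

/-- A core whose body is largest has a module as its body, since a vertex splitting the body could
be inserted into the core. If the body is everything, the core is the spider. Otherwise the module
lemma yields a cut or a `P₄` whose own body contains the old one and its midpoints, against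
maximality. Without any `P₄`, the module lemma is applied to a single vertex. -/
theorem ExtendsP4.hasCut_or_exists_isSpiderPartition [Finite V] [Nontrivial V]
    (hG : G.ExtendsP4) : G.HasCut ∨ ∃ S K, G.IsSpiderPartition S K := by
  by_cases hex : ∃ a b c d, G.IsInducedPath4 a b c d
  · obtain ⟨a, b, c, d, hP⟩ := hex
    obtain ⟨⟨S, K⟩, hSK, hmax⟩ := Set.exists_max_image
      {p : Set V × Set V | G.IsSpiderCore p.1 p.2} (fun p => (G.spiderBody p.1 p.2).ncard)
      (Set.toFinite _) ⟨({a, d}, {b, c}), hP.isSpiderCore hG⟩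
    simp only [Set.mem_ofPred_eq] at hSK
    have hmax' : ∀ S' K', G.IsSpiderCore S' K' → G.spiderBody S K ⊆ G.spiderBody S' K' →
        G.spiderBody S' K' ⊆ G.spiderBody S K := by
      intro S' K' h1 h2
      by_contra h3
      exact (hmax (S', K') h1).not_gt (Set.ncard_lt_ncard ⟨h2, h3⟩ (Set.toFinite _))
    obtain ⟨s₀, hs₀, k₀, hk₀, hsk⟩ := hSK.edge
    obtain ⟨k₁, hk₁, hsk₁⟩ := hSK.nonadj s₀ hs₀
    have hmod : ∀ x ∉ G.spiderBody S K, (∀ y ∈ G.spiderBody S K, G.Adj x y) ∨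
        ∀ y ∈ G.spiderBody S K, ¬ G.Adj x y := by
      intro x hx
      have hxS : x ∉ S := fun h => hx (Or.inl h)
      have hxK : x ∉ K := fun h => hx (Or.inr (Or.inl h))
      obtain ⟨P, Q, hPQ, hS, hK⟩ := hSK.homog x hxS hxK
      by_cases hp : P
      · have hq := hPQ hp
        refine Or.inl ?_
        rintro y (hy | hy | hy)
        · exact (hS y hy).2 hp
        · exact (hK y hy).2 hq
        by_contra hxy
        have hyS : y ∉ S := fun h => hxy ((hS y h).2 hp)
        have hyK : y ∉ K := fun h => hxy ((hK y h).2 hq)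
        -- Here `x` is complete to the core but misses `y`, so `s₀ x k₁ y` is an induced path.
        obtain ⟨h1, h2⟩ := hSK.insert hG (p := y) (q := x) hyK hxS hy.1
          (fun k hk _ => (hK k hk).2 hq) (fun e => hx (e ▸ Or.inr (Or.inr hy)))
          ⟨x, Or.inl rfl, fun h => hxy h.symm⟩
          ⟨s₀, hs₀, k₁, hk₁, Or.inl ⟨((hS _ hs₀).2 hp).symm, (hK _ hk₁).2 hq,
            (hy.2 _ hk₁).symm, hsk₁, fun h => hy.1 _ hs₀ h.symm, hxy⟩⟩
        exact hx (hmax' _ _ h1 h2 (Or.inr (Or.inl (Or.inl rfl))))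
      · have hq : ¬ Q := fun hq => hx (Or.inr (Or.inr
          ⟨fun s hs h => hp ((hS s hs).1 h), fun k hk => (hK k hk).2 hq⟩))
        refine Or.inr ?_
        rintro y (hy | hy | hy) hxy
        · exact hp ((hS y hy).1 hxy)
        · exact hq ((hK y hy).1 hxy)
        have hyS : y ∉ S := fun h => hp ((hS y h).1 hxy)
        -- Here `x` misses the core but sees `y`, so `s₀ k₀ y x` is an induced path.
        obtain ⟨h1, h2⟩ := hSK.insert hG (p := x) (q := y) hxK hyS
          (fun s hs h => hp ((hS s hs).1 h))
          (fun k hk _ => hy.2 k hk) hxy.ne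
          ⟨k₀, Or.inr hk₀, fun h => hq ((hK _ hk₀).1 h)⟩
          ⟨s₀, hs₀, k₀, hk₀, Or.inr ⟨hsk, (hy.2 _ hk₀).symm, hxy.symm,
            fun h => hy.1 _ hs₀ h.symm, fun h => hp ((hS _ hs₀).1 h.symm),
            fun h => hq ((hK _ hk₀).1 h.symm)⟩⟩
        exact hx (hmax' _ _ h1 h2 (Or.inl (Or.inl rfl)))
    by_cases hall : (G.spiderBody S K)ᶜ.Nonempty
    -- A second body vertex `b'` is a twin of `b` as seen from outside, so it would see exactly one
    -- midpoint (or exactly one end) of a path meeting the body only in `b`, contrary to `hG`.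
    · have hother : ∀ b, ∃ b' ∈ G.spiderBody S K, b' ≠ b := by
        intro b
        by_cases hb : s₀ = b
        · exact ⟨k₀, Or.inr (Or.inl hk₀), hb ▸ hsk.ne'⟩
        · exact ⟨s₀, Or.inl hs₀, hb⟩
      have hend : ∀ b ∈ G.spiderBody S K, ∀ a ∉ G.spiderBody S K, ∀ n ∉ G.spiderBody S K,
          ∀ n' ∉ G.spiderBody S K, ¬ G.IsInducedPath4 b a n n' := by
        intro b hb a ha n hn n' hn' hQ
        obtain ⟨b', hb', hne⟩ := hother b
        have h2 := (hG _ _ _ _ b' hQ hne (fun e => ha (e ▸ hb')) (fun e => hn (e ▸ hb'))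
          (fun e => hn' (e ▸ hb'))).2.1
        have ha' := (hmod a ha).resolve_right (fun h => h b hb hQ.ab.symm)
        have hn'' := (hmod n hn).resolve_left (fun h => hQ.ac (h b hb).symm)
        exact hn'' b' hb' (h2.1 (ha' b' hb').symm).symm
      have hmid : ∀ b ∈ G.spiderBody S K, ∀ n ∉ G.spiderBody S K, ∀ a ∉ G.spiderBody S K,
          ∀ a' ∉ G.spiderBody S K, ¬ G.IsInducedPath4 n a b a' := by
        intro b hb n hn a ha a' ha' hQ
        obtain ⟨b', hb', hne⟩ := hother b
        have h2 := (hG _ _ _ _ b' hQ (fun e => hn (e ▸ hb')) (fun e => ha (e ▸ hb')) hne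
          (fun e => ha' (e ▸ hb'))).1
        have ha'' := (hmod a' ha').resolve_right (fun h => h b hb hQ.cd.symm)
        have hn'' := (hmod n hn).resolve_left (fun h => hQ.ac (h b hb))
        exact hn'' b' hb' (h2.2 (ha'' b' hb').symm).symm
      rcases hasCut_or_exists_isInducedPath4_of_module (B := G.spiderBody S K)
        ⟨s₀, Or.inl hs₀⟩ hall hmod hend hmid with h | ⟨n₁, a₁, a₂, n₂, hP', hB⟩
      · exact Or.inl h
      · have hbody : ∀ x ∈ G.spiderBody S K, x ∈ G.spiderBody {n₁, n₂} {a₁, a₂} := by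
          intro x hx
          obtain ⟨h1, h2, h3, h4⟩ := hB x hx
          refine Or.inr (Or.inr ⟨?_, ?_⟩)
          · rintro s (rfl | rfl)
            exacts [fun h => h1 h.symm, fun h => h4 h.symm]
          · rintro s (rfl | rfl)
            exacts [h2.symm, h3.symm]
        have ha := hmax' _ _ (hP'.isSpiderCore hG) hbody (Or.inr (Or.inl (Or.inl rfl)))
        exact (G.irrefl (hB a₁ ha).2.1).elim
    · refine Or.inr ⟨S, K, ⟨s₀, hs₀⟩, hSK.indep, hSK.clique, hSK.disj, hSK.nonadj, ?_⟩
      intro x hxS hxK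
      have hx : x ∈ G.spiderBody S K := by
        by_contra h
        exact hall ⟨x, h⟩
      exact (hx.resolve_left hxS).resolve_left hxK
  · push Not at hex
    obtain ⟨u, v, huv⟩ := exists_pair_ne V
    rcases hasCut_or_exists_isInducedPath4_of_module (G := G) (B := {u}) ⟨u, rfl⟩
      ⟨v, fun h => huv h.symm⟩ (by simp [em]) (fun _ _ _ _ _ _ _ _ => hex _ _ _ _)
      (fun _ _ _ _ _ _ _ _ => hex _ _ _ _) with h | ⟨n₁, a₁, a₂, n₂, hP, -⟩
    · exact Or.inl h
    · exact (hex _ _ _ _ hP).elim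

end Structure

/-! ### Multicolorings and dominated colors. -/

section Multicoloring

variable {V : Type*} {G : SimpleGraph V} {ℓ : ℕ} {X Y Z : Set V} {T T' : Finset ℕ}
  {c c' : V → Finset ℕ}

/-- Every vertex of `X` gets `ℓ` colors from `T`, adjacent vertices get disjoint sets. -/
structure IsMulticoloring (G : SimpleGraph V) (ℓ : ℕ) (X : Set V) (T : Finset ℕ)
    (c : V → Finset ℕ) : Prop where
  subset : ∀ v ∈ X, c v ⊆ T
  card : ∀ v ∈ X, (c v).card = ℓ
  disjoint : ∀ v ∈ X, ∀ w ∈ X, G.Adj v w → Disjoint (c v) (c w)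

/-- All colors of `T` occur in the closed neighborhood of `v` in `X`. -/
def Dominates (G : SimpleGraph V) (X : Set V) (T : Finset ℕ) (c : V → Finset ℕ) (v : V) : Prop :=
  ∀ j ∈ T, ∃ w ∈ X, (w = v ∨ G.Adj v w) ∧ j ∈ c w

open Classical in
/-- The colors of the vertices of `X` that see all of `T`. -/
noncomputable def dominatedColors (G : SimpleGraph V) (X : Set V) (T : Finset ℕ)
    (c : V → Finset ℕ) : Finset ℕ :=
  T.filter fun i => ∃ v ∈ X, i ∈ c v ∧ G.Dominates X T c v

theorem mem_dominatedColors {i : ℕ} : i ∈ G.dominatedColors X T c ↔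
    i ∈ T ∧ ∃ v ∈ X, i ∈ c v ∧ G.Dominates X T c v := by
  simp [dominatedColors]

/-- A multicoloring all of whose colors are dominated. -/
structure IsBMulticoloring (G : SimpleGraph V) (ℓ : ℕ) (X : Set V) (T : Finset ℕ)
    (c : V → Finset ℕ) : Prop extends G.IsMulticoloring ℓ X T c where
  dominated : T ⊆ G.dominatedColors X T c

theorem dominatedColors_mono (hYX : Y ⊆ X) (h : ∀ v ∈ Y, c v = c' v) :
    G.dominatedColors Y T c ⊆ G.dominatedColors X T c' := by
  intro i hi
  obtain ⟨hiT, v, hv, hiv, hdom⟩ := mem_dominatedColors.1 hi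
  refine mem_dominatedColors.2 ⟨hiT, v, hYX hv, h v hv ▸ hiv, fun j hj => ?_⟩
  obtain ⟨w, hw, hvw, hjw⟩ := hdom j hj
  exact ⟨w, hYX hw, hvw, h w hw ▸ hjw⟩

theorem exists_eqOn_eqOn {α β : Type*} {s t : Set α} (h : Disjoint s t) (f g : α → β) :
    ∃ k : α → β, (∀ v ∈ s, k v = f v) ∧ ∀ v ∈ t, k v = g v := by
  classical
  exact ⟨s.piecewise f g, fun v hv => Set.piecewise_eq_of_mem _ _ _ hv,
    fun v hv => Set.piecewise_eq_of_notMem _ _ _ (Set.disjoint_right.1 h hv)⟩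

theorem IsMulticoloring.mono (h : G.IsMulticoloring ℓ X T c) (hYX : Y ⊆ X) (hT : T ⊆ T') :
    G.IsMulticoloring ℓ Y T' c :=
  ⟨fun v hv => (h.subset v (hYX hv)).trans hT, fun v hv => h.card v (hYX hv),
    fun v hv w hw => h.disjoint v (hYX hv) w (hYX hw)⟩

theorem exists_injOn_image_eq {s t : Finset ℕ} (h : s.card = t.card) :
    ∃ f : ℕ → ℕ, Set.InjOn f s ∧ s.image f = t := by
  let e := Finset.equivOfCardEq h
  obtain ⟨f, hf⟩ : ∃ f : ℕ → ℕ, ∀ i (hi : i ∈ s), f i = e ⟨i, hi⟩ :=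
    ⟨fun i => if hi : i ∈ s then (e ⟨i, hi⟩ : ℕ) else i, fun i hi => dif_pos hi⟩
  refine ⟨f, ?_, ?_⟩
  · intro i hi j hj hij
    rw [hf i hi, hf j hj] at hij
    simpa using e.injective (Subtype.ext hij)
  · ext j
    rw [Finset.mem_image]
    constructor
    · rintro ⟨i, hi, rfl⟩
      rw [hf i hi]
      exact (e _).2
    · intro hj
      refine ⟨e.symm ⟨j, hj⟩, (e.symm ⟨j, hj⟩).2, ?_⟩
      rw [hf _ (e.symm ⟨j, hj⟩).2]
      simp

theorem exists_injOn_image_eq_of_subset {s t s₀ t₀ : Finset ℕ} (hs : s₀ ⊆ s) (ht : t₀ ⊆ t)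
    (h : s.card = t.card) (h₀ : s₀.card = t₀.card) :
    ∃ f : ℕ → ℕ, Set.InjOn f s ∧ s.image f = t ∧ s₀.image f = t₀ := by
  obtain ⟨f, hf, hft⟩ := exists_injOn_image_eq h₀
  obtain ⟨g, hg, hgt⟩ := exists_injOn_image_eq (s := s \ s₀) (t := t \ t₀) (by
    rw [Finset.card_sdiff_of_subset hs, Finset.card_sdiff_of_subset ht, h, h₀])
  have e1 : ∀ i ∈ s₀, (fun i => if i ∈ s₀ then f i else g i) i = f i := fun i hi => if_pos hi
  have e2 : ∀ i ∉ s₀, (fun i => if i ∈ s₀ then f i else g i) i = g i := fun i hi => if_neg hi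
  have m1 : ∀ i ∈ s₀, f i ∈ t₀ := fun i hi => hft ▸ Finset.mem_image_of_mem f hi
  have m2 : ∀ i ∈ s, i ∉ s₀ → g i ∉ t₀ := fun i hi hi' => by
    have : g i ∈ t \ t₀ := hgt ▸ Finset.mem_image_of_mem g (Finset.mem_sdiff.2 ⟨hi, hi'⟩)
    exact (Finset.mem_sdiff.1 this).2
  have i1 : s₀.image (fun i => if i ∈ s₀ then f i else g i) = t₀ := by
    rw [← hft]
    exact Finset.image_congr e1
  refine ⟨fun i => if i ∈ s₀ then f i else g i, ?_, ?_, i1⟩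
  · intro i hi j hj hij
    by_cases hi₀ : i ∈ s₀ <;> by_cases hj₀ : j ∈ s₀
    · rw [e1 i hi₀, e1 j hj₀] at hij
      exact hf hi₀ hj₀ hij
    · rw [e1 i hi₀, e2 j hj₀] at hij
      exact (m2 j hj hj₀ (hij ▸ m1 i hi₀)).elim
    · rw [e2 i hi₀, e1 j hj₀] at hij
      exact (m2 i hi hi₀ (hij ▸ m1 j hj₀)).elim
    · rw [e2 i hi₀, e2 j hj₀] at hij
      exact hg (by simpa using ⟨hi, hi₀⟩) (by simpa using ⟨hj, hj₀⟩) hij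
  · rw [← Finset.union_sdiff_of_subset hs, Finset.image_union, i1,
      ← Finset.union_sdiff_of_subset ht, ← hgt]
    congr 1
    refine Finset.image_congr fun i hi => e2 i ?_
    exact (Finset.mem_sdiff.1 (Finset.mem_coe.1 hi)).2

theorem IsMulticoloring.image (h : G.IsMulticoloring ℓ X T c) {f : ℕ → ℕ} (hf : Set.InjOn f T) :
    G.IsMulticoloring ℓ X (T.image f) (fun v => (c v).image f) where
  subset v hv := Finset.image_subset_image (h.subset v hv)
  card v hv := by
    rw [Finset.card_image_of_injOn (hf.mono (Finset.coe_subset.2 (h.subset v hv))), h.card v hv]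
  disjoint v hv w hw hvw := by
    rw [Finset.disjoint_left]
    intro j hj hj'
    obtain ⟨i, hi, rfl⟩ := Finset.mem_image.1 hj
    obtain ⟨i', hi', hii⟩ := Finset.mem_image.1 hj'
    have := hf (h.subset w hw hi') (h.subset v hv hi) hii
    exact Finset.disjoint_left.1 (h.disjoint v hv w hw hvw) hi (this ▸ hi')

theorem image_dominatedColors_subset (f : ℕ → ℕ) :
    (G.dominatedColors X T c).image f ⊆
      G.dominatedColors X (T.image f) (fun v => (c v).image f) := by
  intro j hj
  obtain ⟨i, hi, rfl⟩ := Finset.mem_image.1 hj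
  obtain ⟨hiT, v, hv, hiv, hdom⟩ := mem_dominatedColors.1 hi
  refine mem_dominatedColors.2 ⟨Finset.mem_image_of_mem f hiT, v, hv,
    Finset.mem_image_of_mem f hiv, fun j hj => ?_⟩
  obtain ⟨i', hi', rfl⟩ := Finset.mem_image.1 hj
  obtain ⟨w, hw, hvw, hjw⟩ := hdom i' hi'
  exact ⟨w, hw, hvw, Finset.mem_image_of_mem f hjw⟩

/-- Colors can be permuted so that a prescribed set, if it is not too large, is dominated. -/
theorem IsMulticoloring.exists_rename (h : G.IsMulticoloring ℓ X T c) (hT : T.card = T'.card)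
    {D : Finset ℕ} (hD : D ⊆ T') (hcard : D.card ≤ (G.dominatedColors X T c).card) :
    ∃ c', G.IsMulticoloring ℓ X T' c' ∧ D ⊆ G.dominatedColors X T' c' := by
  obtain ⟨D₀, hD₀, hD₀c⟩ := Finset.exists_subset_card_eq hcard
  obtain ⟨f, hf, rfl, rfl⟩ := exists_injOn_image_eq_of_subset
    (hD₀.trans (fun i hi => (mem_dominatedColors.1 hi).1)) hD hT hD₀c
  exact ⟨_, h.image hf, (Finset.image_subset_image hD₀).trans (image_dominatedColors_subset f)⟩

theorem IsBMulticoloring.exists_rename (h : G.IsBMulticoloring ℓ X T c)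
    (hT : T.card = T'.card) : ∃ c', G.IsBMulticoloring ℓ X T' c' := by
  obtain ⟨c', h1, h2⟩ := h.toIsMulticoloring.exists_rename hT Finset.Subset.rfl
    (hT ▸ Finset.card_le_card h.dominated)
  exact ⟨c', h1, h2⟩

theorem IsMulticoloring.exists_of_card_le (h : G.IsMulticoloring ℓ X T c)
    (hT : T.card ≤ T'.card) : ∃ c', G.IsMulticoloring ℓ X T' c' := by
  obtain ⟨U, hU, hUc⟩ := Finset.exists_subset_card_eq hT
  obtain ⟨c', h', -⟩ := h.exists_rename hUc.symm (Finset.empty_subset _) (by simp)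
  exact ⟨c', h'.mono Set.Subset.rfl hU⟩

/-- A color that is not dominated can be removed without losing dominated colors. -/
theorem IsMulticoloring.exists_erase (h : G.IsMulticoloring ℓ X T c) {x : ℕ}
    (hx : x ∉ G.dominatedColors X T c) (hxT : x ∈ T) :
    ∃ c', G.IsMulticoloring ℓ X (T.erase x) c' ∧
      G.dominatedColors X T c ⊆ G.dominatedColors X (T.erase x) c' := by
  classical
  -- A vertex carrying the undominated color `x` misses some color `y` in its closed neighborhood
  -- and can trade `x` for `y`. Carriers of `x` are pairwise nonadjacent, so all trades can be made
  -- at once.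
  have hfree : ∀ v, ∃ y, v ∈ X → x ∈ c v → y ∈ T ∧ ∀ w ∈ X, (w = v ∨ G.Adj v w) → y ∉ c w := by
    intro v
    by_contra! hcon
    obtain ⟨hv, hxv, -⟩ := hcon 0
    refine hx (mem_dominatedColors.2 ⟨hxT, v, hv, hxv, fun j hj => ?_⟩)
    exact (hcon j).2.2 hj
  choose y hy using hfree
  let c' : V → Finset ℕ := fun v => if x ∈ c v then insert (y v) ((c v).erase x) else c v
  have hpos : ∀ v, x ∈ c v → c' v = insert (y v) ((c v).erase x) := fun v hv => if_pos hv
  have hneg : ∀ v, x ∉ c v → c' v = c v := fun v hv => if_neg hv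
  have hyx : ∀ v ∈ X, x ∈ c v → y v ≠ x := fun v hv hxv e =>
    (hy v hv hxv).2 v hv (Or.inl rfl) (e ▸ hxv)
  have hkeep : ∀ v j, j ≠ x → j ∈ c v → j ∈ c' v := by
    intro v j hj hjv
    by_cases hxv : x ∈ c v
    · rw [hpos v hxv]
      exact Finset.mem_insert_of_mem (Finset.mem_erase.2 ⟨hj, hjv⟩)
    · rwa [hneg v hxv]
  have hdisj : ∀ v ∈ X, ∀ w ∈ X, G.Adj v w → x ∈ c v → Disjoint (c' v) (c' w) := by
    intro v hv w hw hvw hxv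
    have hd := h.disjoint v hv w hw hvw
    have hxw : x ∉ c w := Finset.disjoint_left.1 hd hxv
    rw [hpos v hxv, hneg w hxw, Finset.disjoint_insert_left]
    exact ⟨(hy v hv hxv).2 w hw (Or.inr hvw), hd.mono_left (Finset.erase_subset _ _)⟩
  refine ⟨c', ⟨?_, ?_, ?_⟩, ?_⟩
  · intro v hv
    by_cases hxv : x ∈ c v
    · rw [hpos v hxv, Finset.insert_subset_iff]
      exact ⟨Finset.mem_erase.2 ⟨hyx v hv hxv, (hy v hv hxv).1⟩,
        Finset.erase_subset_erase _ (h.subset v hv)⟩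
    · rw [hneg v hxv, Finset.subset_erase]
      exact ⟨h.subset v hv, hxv⟩
  · intro v hv
    by_cases hxv : x ∈ c v
    · rw [hpos v hxv, Finset.card_insert_of_notMem, Finset.card_erase_add_one hxv, h.card v hv]
      exact fun h' => (hy v hv hxv).2 v hv (Or.inl rfl) (Finset.mem_of_mem_erase h')
    · rw [hneg v hxv, h.card v hv]
  · intro v hv w hw hvw
    by_cases hxv : x ∈ c v
    · exact hdisj v hv w hw hvw hxv
    by_cases hxw : x ∈ c w
    · exact (hdisj w hw v hv hvw.symm hxw).symm
    · rw [hneg v hxv, hneg w hxw]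
      exact h.disjoint v hv w hw hvw
  · intro i hi
    have hix : i ≠ x := fun e => hx (e ▸ hi)
    obtain ⟨hiT, v, hv, hiv, hdom⟩ := mem_dominatedColors.1 hi
    refine mem_dominatedColors.2 ⟨Finset.mem_erase.2 ⟨hix, hiT⟩, v, hv, hkeep v i hix hiv,
      fun j hj => ?_⟩
    obtain ⟨w, hw, hvw, hjw⟩ := hdom j (Finset.mem_of_mem_erase hj)
    exact ⟨w, hw, hvw, hkeep w j (Finset.ne_of_mem_erase hj) hjw⟩

/-! ### Descent by one color through unions, joins and spiders. -/

/-- From a multicoloring with all colors dominated one can pass to one color less, as long as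
there is any multicoloring with that many colors. -/
def DescendsOn (G : SimpleGraph V) (ℓ : ℕ) (X : Set V) : Prop :=
  ∀ T T' : Finset ℕ, T'.card + 1 = T.card → (∃ c, G.IsBMulticoloring ℓ X T c) →
    (∃ c, G.IsMulticoloring ℓ X T' c) → ∃ c, G.IsBMulticoloring ℓ X T' c

/-- If some color is undominated, it is erased at no cost; if none is, the descent hypothesis
applies. Either way, renaming lets the surviving dominated colors be prescribed. -/
theorem DescendsOn.exists_dominated (hX : G.DescendsOn ℓ X) (h : G.IsMulticoloring ℓ X T c)
    (hT : T'.card + 1 = T.card) (hT' : ∃ c, G.IsMulticoloring ℓ X T' c) {D : Finset ℕ}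
    (hD : D ⊆ T') (hcard : D.card ≤ (G.dominatedColors X T c).card) :
    ∃ c', G.IsMulticoloring ℓ X T' c' ∧ D ⊆ G.dominatedColors X T' c' := by
  by_cases hdom : T ⊆ G.dominatedColors X T c
  · obtain ⟨c', h'⟩ := hX T T' hT ⟨c, h, hdom⟩ hT'
    exact ⟨c', h'.toIsMulticoloring, hD.trans h'.dominated⟩
  · obtain ⟨x, hxT, hx⟩ := Finset.not_subset.1 hdom
    obtain ⟨c', h', hsub⟩ := h.exists_erase hx hxT
    refine h'.exists_rename ?_ hD (hcard.trans (Finset.card_le_card hsub))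
    rw [Finset.card_erase_of_mem hxT]
    omega

theorem DescendsOn.union_of_not_adj (hY : G.DescendsOn ℓ Y) (hZ : G.DescendsOn ℓ Z)
    (hYZ : Disjoint Y Z) (hno : ∀ y ∈ Y, ∀ z ∈ Z, ¬ G.Adj y z) : G.DescendsOn ℓ (Y ∪ Z) := by
  classical
  rintro T T' hT ⟨c, hc⟩ ⟨c₀, hc₀⟩
  have hsub : T ⊆ G.dominatedColors Y T c ∪ G.dominatedColors Z T c := by
    intro i hi
    obtain ⟨-, v, hv, hiv, hdom⟩ := mem_dominatedColors.1 (hc.dominated hi)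
    rcases hv with hv | hv
    · refine Finset.mem_union_left _ (mem_dominatedColors.2 ⟨hi, v, hv, hiv, fun j hj => ?_⟩)
      obtain ⟨w, hw, hvw, hjw⟩ := hdom j hj
      refine ⟨w, hw.resolve_right fun hw' => ?_, hvw, hjw⟩
      rcases hvw with rfl | hvw
      exacts [Set.disjoint_left.1 hYZ hv hw', hno v hv w hw' hvw]
    · refine Finset.mem_union_right _ (mem_dominatedColors.2 ⟨hi, v, hv, hiv, fun j hj => ?_⟩)
      obtain ⟨w, hw, hvw, hjw⟩ := hdom j hj
      refine ⟨w, hw.resolve_left fun hw' => ?_, hvw, hjw⟩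
      rcases hvw with rfl | hvw
      exacts [Set.disjoint_left.1 hYZ hw' hv, hno w hw' v hv hvw.symm]
  have hle := (Finset.card_le_card hsub).trans (Finset.card_union_le _ _)
  -- The dominated colors of the two parts number at least `T.card` together, so `Y` can be assigned
  -- `D` and `Z` the rest of `T'`.
  obtain ⟨D, hD, hDc⟩ := Finset.exists_subset_card_eq
    (min_le_right (G.dominatedColors Y T c).card T'.card)
  obtain ⟨c₁, h₁, hD₁⟩ := hY.exists_dominated (hc.mono Set.subset_union_left Finset.Subset.rfl) hT
    ⟨c₀, hc₀.mono Set.subset_union_left Finset.Subset.rfl⟩ hD (by omega)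
  obtain ⟨c₂, h₂, hD₂⟩ := hZ.exists_dominated (hc.mono Set.subset_union_right Finset.Subset.rfl) hT
    ⟨c₀, hc₀.mono Set.subset_union_right Finset.Subset.rfl⟩
    (Finset.sdiff_subset : T' \ D ⊆ T') (by rw [Finset.card_sdiff_of_subset hD]; omega)
  obtain ⟨d, e1, e2⟩ := exists_eqOn_eqOn hYZ c₁ c₂
  refine ⟨d, ⟨?_, ?_, ?_⟩, ?_⟩
  · rintro v (hv | hv)
    exacts [(e1 v hv).symm ▸ h₁.subset v hv, (e2 v hv).symm ▸ h₂.subset v hv]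
  · rintro v (hv | hv)
    exacts [(e1 v hv).symm ▸ h₁.card v hv, (e2 v hv).symm ▸ h₂.card v hv]
  · rintro v (hv | hv) w (hw | hw) hvw
    · rw [e1 v hv, e1 w hw]
      exact h₁.disjoint v hv w hw hvw
    · exact (hno v hv w hw hvw).elim
    · exact (hno w hw v hv hvw.symm).elim
    · rw [e2 v hv, e2 w hw]
      exact h₂.disjoint v hv w hw hvw
  · rw [← Finset.union_sdiff_of_subset hD]
    refine Finset.union_subset ?_ ?_ <;> rw [Finset.union_sdiff_of_subset hD]
    · exact hD₁.trans (dominatedColors_mono Set.subset_union_left fun v hv => (e1 v hv).symm)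
    · exact hD₂.trans (dominatedColors_mono Set.subset_union_right fun v hv => (e2 v hv).symm)

theorem IsBMulticoloring.exists_join {c₁ c₂ : V → Finset ℕ} {T₁ T₂ : Finset ℕ}
    (h₁ : G.IsBMulticoloring ℓ Y T₁ c₁) (h₂ : G.IsBMulticoloring ℓ Z T₂ c₂)
    (hT : Disjoint T₁ T₂) (hYZ : ∀ y ∈ Y, ∀ z ∈ Z, G.Adj y z) :
    ∃ c, G.IsBMulticoloring ℓ (Y ∪ Z) (T₁ ∪ T₂) c := by
  obtain ⟨d, e1, e2⟩ := exists_eqOn_eqOn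
    (Set.disjoint_left.2 fun v hy hz => G.irrefl (hYZ v hy v hz)) c₁ c₂
  refine ⟨d, ⟨?_, ?_, ?_⟩, ?_⟩
  · rintro v (hv | hv)
    · rw [e1 v hv]
      exact (h₁.subset v hv).trans Finset.subset_union_left
    · rw [e2 v hv]
      exact (h₂.subset v hv).trans Finset.subset_union_right
  · rintro v (hv | hv)
    · rw [e1 v hv, h₁.card v hv]
    · rw [e2 v hv, h₂.card v hv]
  · rintro v (hv | hv) w (hw | hw) hvw
    · rw [e1 v hv, e1 w hw]
      exact h₁.disjoint v hv w hw hvw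
    · rw [e1 v hv, e2 w hw]
      exact hT.mono (h₁.subset v hv) (h₂.subset w hw)
    · rw [e2 v hv, e1 w hw]
      exact hT.symm.mono (h₂.subset v hv) (h₁.subset w hw)
    · rw [e2 v hv, e2 w hw]
      exact h₂.disjoint v hv w hw hvw
  · have hused : ∀ j ∈ T₂, ∃ w ∈ Z, j ∈ c₂ w := fun j hj =>
      let ⟨_, w, hw, hjw, _⟩ := mem_dominatedColors.1 (h₂.dominated hj)
      ⟨w, hw, hjw⟩
    have hused' : ∀ j ∈ T₁, ∃ w ∈ Y, j ∈ c₁ w := fun j hj =>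
      let ⟨_, w, hw, hjw, _⟩ := mem_dominatedColors.1 (h₁.dominated hj)
      ⟨w, hw, hjw⟩
    intro i hi
    refine mem_dominatedColors.2 ⟨hi, ?_⟩
    rcases Finset.mem_union.1 hi with hi | hi
    · obtain ⟨-, v, hv, hiv, hdom⟩ := mem_dominatedColors.1 (h₁.dominated hi)
      refine ⟨v, Or.inl hv, by rwa [e1 v hv], fun j hj => ?_⟩
      rcases Finset.mem_union.1 hj with hj | hj
      · obtain ⟨w, hw, hvw, hjw⟩ := hdom j hj
        exact ⟨w, Or.inl hw, hvw, by rwa [e1 w hw]⟩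
      · obtain ⟨w, hw, hjw⟩ := hused j hj
        exact ⟨w, Or.inr hw, Or.inr (hYZ v hv w hw), by rwa [e2 w hw]⟩
    · obtain ⟨-, v, hv, hiv, hdom⟩ := mem_dominatedColors.1 (h₂.dominated hi)
      refine ⟨v, Or.inr hv, by rwa [e2 v hv], fun j hj => ?_⟩
      rcases Finset.mem_union.1 hj with hj | hj
      · obtain ⟨w, hw, hjw⟩ := hused' j hj
        exact ⟨w, Or.inl hw, Or.inr (hYZ w hw v hv).symm, by rwa [e1 w hw]⟩
      · obtain ⟨w, hw, hvw, hjw⟩ := hdom j hj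
        exact ⟨w, Or.inr hw, hvw, by rwa [e2 w hw]⟩

/-- As `Y` can be multicolored with fewer than `T₁.card` colors, it can give up one color while `Z`
stays unchanged. -/
theorem DescendsOn.exists_join {c₁ c₂ c₀ : V → Finset ℕ} {T₁ T₂ T₀ : Finset ℕ}
    (hY : G.DescendsOn ℓ Y) (h₁ : G.IsBMulticoloring ℓ Y T₁ c₁)
    (h₂ : G.IsBMulticoloring ℓ Z T₂ c₂) (hT : Disjoint T₁ T₂)
    (hYZ : ∀ y ∈ Y, ∀ z ∈ Z, G.Adj y z) (h₀ : G.IsMulticoloring ℓ Y T₀ c₀)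
    (hlt : T₀.card < T₁.card) (hT' : T'.card + 1 = T₁.card + T₂.card) :
    ∃ c, G.IsBMulticoloring ℓ (Y ∪ Z) T' c := by
  obtain ⟨x, hx⟩ : T₁.Nonempty := Finset.card_pos.1 (by omega)
  have hcard := Finset.card_erase_add_one hx
  obtain ⟨c, hc⟩ := hY T₁ (T₁.erase x) hcard ⟨c₁, h₁⟩ (h₀.exists_of_card_le (by omega))
  have hdis : Disjoint (T₁.erase x) T₂ := hT.mono_left (Finset.erase_subset _ _)
  obtain ⟨c', hc'⟩ := hc.exists_join h₂ hdis hYZ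
  refine hc'.exists_rename ?_
  rw [Finset.card_union_of_disjoint hdis]
  omega

/-- Both colorings split into disjoint palettes for `Y` and `Z`. Since `U₁.card + U₂.card < T₁.card
+ T₂.card`, one side has a spare color and descends. -/
theorem DescendsOn.union_of_adj (hY : G.DescendsOn ℓ Y) (hZ : G.DescendsOn ℓ Z)
    (hYZ : ∀ y ∈ Y, ∀ z ∈ Z, G.Adj y z) : G.DescendsOn ℓ (Y ∪ Z) := by
  classical
  rintro T T' hT ⟨c, hc⟩ ⟨c₀, hc₀⟩
  have hsplit : ∀ (T : Finset ℕ) (c : V → Finset ℕ), G.IsMulticoloring ℓ (Y ∪ Z) T c →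
      ∃ T₁ ⊆ T, ∃ T₂ ⊆ T, Disjoint T₁ T₂ ∧ (∀ v ∈ Y, c v ⊆ T₁) ∧ ∀ v ∈ Z, c v ⊆ T₂ := by
    intro T c h
    refine ⟨T.filter fun i => ∃ v ∈ Y, i ∈ c v, Finset.filter_subset _ _,
      T.filter fun i => ∃ v ∈ Z, i ∈ c v, Finset.filter_subset _ _, ?_, ?_, ?_⟩
    · rw [Finset.disjoint_left]
      intro i hi hi'
      obtain ⟨v, hv, hiv⟩ := (Finset.mem_filter.1 hi).2
      obtain ⟨w, hw, hiw⟩ := (Finset.mem_filter.1 hi').2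
      exact Finset.disjoint_left.1 (h.disjoint v (Or.inl hv) w (Or.inr hw) (hYZ v hv w hw)) hiv hiw
    · exact fun v hv i hi => Finset.mem_filter.2 ⟨h.subset v (Or.inl hv) hi, v, hv, hi⟩
    · exact fun v hv i hi => Finset.mem_filter.2 ⟨h.subset v (Or.inr hv) hi, v, hv, hi⟩
  obtain ⟨T₁, hT₁, T₂, hT₂, hd, hY₁, hZ₂⟩ := hsplit T c hc.toIsMulticoloring
  obtain ⟨U₁, hU₁, U₂, hU₂, hdU, hYU, hZU⟩ := hsplit T' c₀ hc₀
  have h₁ : G.IsBMulticoloring ℓ Y T₁ c := by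
    refine ⟨⟨hY₁, fun v hv => hc.card v (Or.inl hv),
      fun v hv w hw => hc.disjoint v (Or.inl hv) w (Or.inl hw)⟩, fun i hi => ?_⟩
    obtain ⟨-, v, hv, hiv, hdom⟩ := mem_dominatedColors.1 (hc.dominated (hT₁ hi))
    have hv' := hv.resolve_right fun hv' => Finset.disjoint_left.1 hd hi (hZ₂ v hv' hiv)
    refine mem_dominatedColors.2 ⟨hi, v, hv', hiv, fun j hj => ?_⟩
    obtain ⟨w, hw, hvw, hjw⟩ := hdom j (hT₁ hj)
    exact ⟨w, hw.resolve_right fun hw' => Finset.disjoint_left.1 hd hj (hZ₂ w hw' hjw), hvw, hjw⟩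
  have h₂ : G.IsBMulticoloring ℓ Z T₂ c := by
    refine ⟨⟨hZ₂, fun v hv => hc.card v (Or.inr hv),
      fun v hv w hw => hc.disjoint v (Or.inr hv) w (Or.inr hw)⟩, fun i hi => ?_⟩
    obtain ⟨-, v, hv, hiv, hdom⟩ := mem_dominatedColors.1 (hc.dominated (hT₂ hi))
    have hv' := hv.resolve_left fun hv' => Finset.disjoint_right.1 hd hi (hY₁ v hv' hiv)
    refine mem_dominatedColors.2 ⟨hi, v, hv', hiv, fun j hj => ?_⟩
    obtain ⟨w, hw, hvw, hjw⟩ := hdom j (hT₂ hj)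
    exact ⟨w, hw.resolve_left fun hw' => Finset.disjoint_right.1 hd hj (hY₁ w hw' hjw), hvw, hjw⟩
  have h₁₀ : G.IsMulticoloring ℓ Y U₁ c₀ := ⟨hYU, fun v hv => hc₀.card v (Or.inl hv),
      fun v hv w hw => hc₀.disjoint v (Or.inl hv) w (Or.inl hw)⟩
  have h₂₀ : G.IsMulticoloring ℓ Z U₂ c₀ := ⟨hZU, fun v hv => hc₀.card v (Or.inr hv),
      fun v hv w hw => hc₀.disjoint v (Or.inr hv) w (Or.inr hw)⟩
  have hTc : T.card = T₁.card + T₂.card := by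
    rw [← Finset.card_union_of_disjoint hd]
    congr 1
    refine Finset.Subset.antisymm (fun i hi => ?_) (Finset.union_subset hT₁ hT₂)
    obtain ⟨-, v, hv, hiv, -⟩ := mem_dominatedColors.1 (hc.dominated hi)
    rcases hv with hv | hv
    exacts [Finset.mem_union_left _ (hY₁ v hv hiv), Finset.mem_union_right _ (hZ₂ v hv hiv)]
  have hUc : U₁.card + U₂.card ≤ T'.card := by
    rw [← Finset.card_union_of_disjoint hdU]
    exact Finset.card_le_card (Finset.union_subset hU₁ hU₂)
  by_cases hlt : U₁.card < T₁.card
  · exact hY.exists_join h₁ h₂ hd hYZ h₁₀ hlt (by omega)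
  · rw [Set.union_comm]
    exact hZ.exists_join h₂ h₁ hd.symm (fun z hz y hy => (hYZ y hy z hz).symm) h₂₀ (by omega)
      (by omega)

/-- The clique forces `K.card * ℓ ≤ T'.card < T.card`, while a leg misses a vertex of `K` and so,
with its own `ℓ` colors, sees at most `K.card * ℓ`. Hence no leg dominates, and the same count
leaves `ℓ` free colors for each leg after the descent on `X`. -/
theorem DescendsOn.union_of_spider (hX : G.DescendsOn ℓ X) {S : Set V} {K : Finset V}
    (hKX : (K : Set V) ⊆ X) (hSX : Disjoint S X) (hS : ∀ s ∈ S, ∀ s' ∈ S, ¬ G.Adj s s')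
    (hSK : ∀ s ∈ S, ∃ k ∈ K, ¬ G.Adj s k) (hSR : ∀ s ∈ S, ∀ x ∈ X, G.Adj s x → x ∈ K)
    (hK : ∀ k ∈ K, ∀ x ∈ X, k ≠ x → G.Adj k x) : G.DescendsOn ℓ (S ∪ X) := by
  classical
  rintro T T' hT ⟨c, hc⟩ ⟨c₀, hc₀⟩
  have hKT : K.card * ℓ ≤ T'.card := by
    have hdis : (K : Set V).PairwiseDisjoint c₀ := fun k hk k' hk' hne =>
      hc₀.disjoint k (Or.inr (hKX hk)) k' (Or.inr (hKX hk')) (hK k hk k' (hKX hk') hne)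
    rw [← Finset.sum_const_nat (fun k hk => hc₀.card k (Or.inr (hKX hk))),
      ← Finset.card_biUnion hdis]
    exact Finset.card_le_card (Finset.biUnion_subset.2 fun k hk => hc₀.subset k (Or.inr (hKX hk)))
  have hnbr : ∀ s ∈ S, ∀ d : V → Finset ℕ, (∀ k ∈ K, (d k).card = ℓ) →
      ((K.filter (G.Adj s)).biUnion d).card + ℓ ≤ K.card * ℓ := by
    intro s hs d hd
    obtain ⟨k, hk, hsk⟩ := hSK s hs
    have h1 : (K.filter (G.Adj s)).card < K.card := Finset.card_lt_card
      ⟨Finset.filter_subset _ _, fun h => hsk (Finset.mem_filter.1 (h hk)).2⟩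
    have h2 := Finset.card_biUnion_le_card_mul (K.filter (G.Adj s)) d ℓ
      fun k hk => (hd k (Finset.mem_filter.1 hk).1).le
    calc _ ≤ ((K.filter (G.Adj s)).card + 1) * ℓ := by rw [add_one_mul]; omega
      _ ≤ _ := Nat.mul_le_mul_right _ h1
  have hSdom : ∀ s ∈ S, ¬ G.Dominates (S ∪ X) T c s := by
    intro s hs hdom
    have hsub : T ⊆ (K.filter (G.Adj s)).biUnion c ∪ c s := by
      intro j hj
      obtain ⟨w, hw, hsw, hjw⟩ := hdom j hj
      rcases hsw with rfl | hsw
      · exact Finset.mem_union_right _ hjw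
      · refine Finset.mem_union_left _ (Finset.mem_biUnion.2 ⟨w, Finset.mem_filter.2 ⟨?_, hsw⟩, hjw⟩)
        exact hSR s hs w (hw.resolve_left fun hw' => hS s hs w hw' hsw) hsw
    have h1 := (Finset.card_le_card hsub).trans (Finset.card_union_le _ _)
    have h2 := hnbr s hs c fun k hk => hc.card k (Or.inr (hKX hk))
    rw [hc.card s (Or.inl hs)] at h1
    omega
  have hdomX : ∀ i ∈ T, ∃ v ∈ X, i ∈ c v ∧ G.Dominates (S ∪ X) T c v := by
    intro i hi
    obtain ⟨-, v, hv, hiv, hdom⟩ := mem_dominatedColors.1 (hc.dominated hi)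
    exact ⟨v, hv.resolve_left fun hv' => hSdom v hv' hdom, hiv, hdom⟩
  have hcX : G.IsBMulticoloring ℓ X T c := by
    refine ⟨hc.mono Set.subset_union_right Finset.Subset.rfl, fun i hi => ?_⟩
    obtain ⟨v, hv, hiv, hdom⟩ := hdomX i hi
    refine mem_dominatedColors.2 ⟨hi, v, hv, hiv, fun j hj => ?_⟩
    -- Only vertices of `K` lose neighbors when the legs are deleted; they see all of `X`, where
    -- every color still occurs.
    by_cases hvK : v ∈ K
    · obtain ⟨w, hw, hjw, -⟩ := hdomX j hj
      refine ⟨w, hw, ?_, hjw⟩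
      by_cases hwv : w = v
      exacts [Or.inl hwv, Or.inr (hK v hvK w hw (Ne.symm hwv))]
    · obtain ⟨w, hw, hvw, hjw⟩ := hdom j hj
      refine ⟨w, hw.resolve_left fun hw' => ?_, hvw, hjw⟩
      rcases hvw with rfl | hvw
      exacts [Set.disjoint_left.1 hSX hw' hv, hvK (hSR w hw' v hv hvw.symm)]
  obtain ⟨d, hd⟩ := hX T T' hT ⟨c, hcX⟩ ⟨c₀, hc₀.mono Set.subset_union_right Finset.Subset.rfl⟩
  have hfree : ∀ s, ∃ F : Finset ℕ, s ∈ S →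
      F ⊆ T' \ (K.filter (G.Adj s)).biUnion d ∧ F.card = ℓ := by
    intro s
    by_cases hs : s ∈ S
    · have h1 := hnbr s hs d fun k hk => hd.card k (hKX hk)
      have h2 := Finset.le_card_sdiff ((K.filter (G.Adj s)).biUnion d) T'
      obtain ⟨F, hF⟩ := Finset.exists_subset_card_eq
        (show ℓ ≤ (T' \ (K.filter (G.Adj s)).biUnion d).card by omega)
      exact ⟨F, fun _ => hF⟩
    · exact ⟨∅, fun h => (hs h).elim⟩
  choose F hF using hfree
  obtain ⟨f, e1, e2⟩ := exists_eqOn_eqOn hSX F d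
  have hFd : ∀ s ∈ S, ∀ x ∈ X, G.Adj s x → Disjoint (F s) (d x) := by
    intro s hs x hx hsx
    rw [Finset.disjoint_left]
    intro i hi hix
    exact (Finset.mem_sdiff.1 ((hF s hs).1 hi)).2
      (Finset.mem_biUnion.2 ⟨x, Finset.mem_filter.2 ⟨hSR s hs x hx hsx, hsx⟩, hix⟩)
  refine ⟨f, ⟨?_, ?_, ?_⟩, ?_⟩
  · rintro v (hv | hv)
    · rw [e1 v hv]
      exact (hF v hv).1.trans Finset.sdiff_subset
    · rw [e2 v hv]
      exact hd.subset v hv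
  · rintro v (hv | hv)
    · rw [e1 v hv, (hF v hv).2]
    · rw [e2 v hv, hd.card v hv]
  · rintro v (hv | hv) w (hw | hw) hvw
    · exact (hS v hv w hw hvw).elim
    · rw [e1 v hv, e2 w hw]
      exact hFd v hv w hw hvw
    · rw [e2 v hv, e1 w hw]
      exact (hFd w hw v hv hvw.symm).symm
    · rw [e2 v hv, e2 w hw]
      exact hd.disjoint v hv w hw hvw
  · exact hd.dominated.trans
      (dominatedColors_mono Set.subset_union_right fun v hv => (e2 v hv).symm)

/-- Vacuous: a dominating single vertex gives `T.card ≤ ℓ`, and any multicoloring with `T'` gives `ℓ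
≤ T'.card`. -/
theorem descendsOn_of_subsingleton (hX : X.Subsingleton) : G.DescendsOn ℓ X := by
  rintro T T' hT ⟨c, hc⟩ ⟨c₀, hc₀⟩
  exfalso
  obtain ⟨i, hi⟩ : T.Nonempty := Finset.card_pos.1 (by omega)
  obtain ⟨-, v, hv, -, hdom⟩ := mem_dominatedColors.1 (hc.dominated hi)
  have h1 : T ⊆ c v := by
    intro j hj
    obtain ⟨w, hw, -, hjw⟩ := hdom j hj
    exact hX hw hv ▸ hjw
  have h2 := Finset.card_le_card h1
  have h3 := Finset.card_le_card (hc₀.subset v hv)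
  rw [hc.card v hv] at h2
  rw [hc₀.card v hv] at h3
  omega

theorem ExtendsP4.descendsOn [Finite V] (hG : G.ExtendsP4) (X : Set V) : G.DescendsOn ℓ X := by
  classical
  induction hn : X.ncard using Nat.strong_induction_on generalizing X with
  | _ n ih =>
  subst hn
  have ih' : ∀ Y ⊂ X, G.DescendsOn ℓ Y := fun Y hY =>
    ih _ (Set.ncard_lt_ncard hY X.toFinite) Y rfl
  by_cases hX : X.Subsingleton
  · exact descendsOn_of_subsingleton hX
  have : Nontrivial X := Set.nontrivial_coe_sort.2 (Set.not_subsingleton_iff.1 hX)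
  rcases (hG.induce X).hasCut_or_exists_isSpiderPartition with
    ⟨A, ⟨a, ha⟩, ⟨b, hb⟩, h⟩ | ⟨S, K, hSK⟩
  · have hY : Subtype.val '' A ⊂ X := by
      refine ⟨by rintro _ ⟨v, -, rfl⟩; exact v.2, fun hsub => ?_⟩
      obtain ⟨v, hv, hvb⟩ := hsub b.2
      exact hb (Subtype.ext hvb ▸ hv)
    have hZ : Subtype.val '' Aᶜ ⊂ X := by
      refine ⟨by rintro _ ⟨v, -, rfl⟩; exact v.2, fun hsub => ?_⟩
      obtain ⟨v, hv, hvb⟩ := hsub a.2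
      exact hv (Subtype.ext hvb ▸ ha)
    have hXe : X = Subtype.val '' A ∪ Subtype.val '' Aᶜ := by
      rw [← Set.image_union, Set.union_compl_self, Set.image_univ, Subtype.range_coe]
    rw [hXe]
    rcases h with h | h
    · refine (ih' _ hY).union_of_not_adj (ih' _ hZ)
        ((Set.disjoint_image_iff Subtype.val_injective).2 disjoint_compl_right) ?_
      rintro _ ⟨v, hv, rfl⟩ _ ⟨w, hw, rfl⟩
      exact h v hv w hw
    · refine (ih' _ hY).union_of_adj (ih' _ hZ) ?_
      rintro _ ⟨v, hv, rfl⟩ _ ⟨w, hw, rfl⟩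
      exact h v hv w hw
  · have hY : Subtype.val '' Sᶜ ⊂ X := by
      refine ⟨by rintro _ ⟨v, -, rfl⟩; exact v.2, fun hsub => ?_⟩
      obtain ⟨s, hs⟩ := hSK.nonempty
      obtain ⟨v, hv, hvs⟩ := hsub s.2
      exact hv (Subtype.ext hvs ▸ hs)
    have hXe : X = Subtype.val '' S ∪ Subtype.val '' Sᶜ := by
      rw [← Set.image_union, Set.union_compl_self, Set.image_univ, Subtype.range_coe]
    have hmem : ∀ v, v ∈ (Subtype.val '' K).toFinite.toFinset ↔ v ∈ Subtype.val '' K :=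
      fun v => Set.Finite.mem_toFinset _
    rw [hXe]
    refine (ih' _ hY).union_of_spider (K := (Subtype.val '' K).toFinite.toFinset) ?_
      ((Set.disjoint_image_iff Subtype.val_injective).2 disjoint_compl_right) ?_ ?_ ?_ ?_
    · rw [Set.Finite.coe_toFinset]
      exact Set.image_mono fun k hk hk' => hSK.disj k hk' hk
    · rintro _ ⟨v, hv, rfl⟩ _ ⟨w, hw, rfl⟩
      exact hSK.indep v hv w hw
    · rintro _ ⟨s, hs, rfl⟩
      obtain ⟨k, hk, hsk⟩ := hSK.nonadj s hs
      exact ⟨k, (hmem _).2 ⟨k, hk, rfl⟩, hsk⟩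
    · rintro _ ⟨s, hs, rfl⟩ _ ⟨x, hx, rfl⟩ hsx
      rw [hmem]
      refine ⟨x, ?_, rfl⟩
      by_contra hxK
      exact (hSK.rest x hx hxK).1 s hs hsx.symm
    · intro k' hk' x' hx' hne
      rw [hmem] at hk'
      obtain ⟨k, hk, rfl⟩ := hk'
      obtain ⟨x, hx, rfl⟩ := hx'
      by_cases hxK : x ∈ K
      · exact hSK.clique k hk x hxK fun e => hne (e ▸ rfl)
      · exact ((hSK.rest x hx hxK).2 k hk).symm

/-! ### Translation to colorings of the lexicographic product. -/

/-- The colors, as natural numbers, on the copy of the complete graph at each vertex. -/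
def Coloring.fiberColors {k : ℕ} (C : (G.lexProduct (completeGraph (Fin ℓ))).Coloring (Fin k))
    (v : V) : Finset ℕ :=
  Finset.univ.image fun i => (C (v, i) : ℕ)

theorem Coloring.isMulticoloring_fiberColors {k : ℕ}
    (C : (G.lexProduct (completeGraph (Fin ℓ))).Coloring (Fin k)) :
    G.IsMulticoloring ℓ Set.univ (Finset.range k) C.fiberColors where
  subset v _ := by
    intro j hj
    obtain ⟨i, -, rfl⟩ := Finset.mem_image.1 hj
    exact Finset.mem_range.2 (C (v, i)).2
  card v _ := by
    rw [Coloring.fiberColors, Finset.card_image_of_injective, Finset.card_univ, Fintype.card_fin]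
    intro i j hij
    by_contra hne
    exact C.valid (v := (v, i)) (w := (v, j)) (Or.inl ⟨rfl, hne⟩) (Fin.ext hij)
  disjoint v _ w _ hvw := by
    rw [Finset.disjoint_left]
    intro j hj hj'
    obtain ⟨i, -, rfl⟩ := Finset.mem_image.1 hj
    obtain ⟨i', -, hii⟩ := Finset.mem_image.1 hj'
    exact C.valid (v := (v, i)) (w := (w, i')) (Or.inr hvw) (Fin.ext hii.symm)

theorem Coloring.IsBColoring.isBMulticoloring_fiberColors {k : ℕ}
    {C : (G.lexProduct (completeGraph (Fin ℓ))).Coloring (Fin k)} (hC : C.IsBColoring) :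
    G.IsBMulticoloring ℓ Set.univ (Finset.range k) C.fiberColors where
  toIsMulticoloring := C.isMulticoloring_fiberColors
  dominated := by
    intro i hi
    obtain ⟨⟨v, a⟩, hv, hb⟩ := hC ⟨i, Finset.mem_range.1 hi⟩
    refine mem_dominatedColors.2 ⟨hi, v, trivial,
      Finset.mem_image.2 ⟨a, Finset.mem_univ _, by rw [hv]⟩, fun j hj => ?_⟩
    by_cases hj' : (⟨j, Finset.mem_range.1 hj⟩ : Fin k) = C (v, a)
    · exact ⟨v, trivial, Or.inl rfl, Finset.mem_image.2 ⟨a, Finset.mem_univ _, by rw [← hj']⟩⟩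
    · obtain ⟨⟨w, b⟩, hadj, hw⟩ := hb _ hj'
      refine ⟨w, trivial, ?_, Finset.mem_image.2 ⟨b, Finset.mem_univ _, by rw [hw]⟩⟩
      exact hadj.imp (fun h => h.1.symm) id

theorem IsBMulticoloring.hasBColoring {k : ℕ}
    (hc : G.IsBMulticoloring ℓ Set.univ (Finset.range k) c) :
    (G.lexProduct (completeGraph (Fin ℓ))).HasBColoring k := by
  let e : ∀ v, Fin ℓ ≃ c v := fun v => ((c v).equivFinOfCardEq (hc.card v trivial)).symm
  let C : (G.lexProduct (completeGraph (Fin ℓ))).Coloring (Fin k) := Coloring.mk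
    (fun p => ⟨e p.1 p.2, Finset.mem_range.1 (hc.subset p.1 trivial (e p.1 p.2).2)⟩) (by
      rintro ⟨v, i⟩ ⟨w, j⟩ hadj heq
      simp only [Fin.mk.injEq] at heq
      rcases hadj with ⟨h1, h2⟩ | h
      · obtain rfl : v = w := h1
        exact h2 ((e v).injective (Subtype.ext heq))
      · exact Finset.disjoint_left.1 (hc.disjoint v trivial w trivial h) (e v i).2
          (heq ▸ (e w j).2))
  have hC : ∀ v i (hi : i ∈ c v), (C (v, (e v).symm ⟨i, hi⟩) : ℕ) = i := by
    intro v i hi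
    change ((e v ((e v).symm ⟨i, hi⟩) : c v) : ℕ) = i
    rw [Equiv.apply_symm_apply]
  refine ⟨C, fun i => ?_⟩
  obtain ⟨-, v, -, hiv, hdom⟩ := mem_dominatedColors.1 (hc.dominated (Finset.mem_range.2 i.2))
  refine ⟨(v, (e v).symm ⟨i, hiv⟩), Fin.ext (hC v i hiv), fun j hj => ?_⟩
  obtain ⟨w, -, hvw, hjw⟩ := hdom j (Finset.mem_range.2 j.2)
  refine ⟨(w, (e w).symm ⟨j, hjw⟩), ?_, Fin.ext (hC w j hjw)⟩
  rcases hvw with rfl | hvw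
  -- A color found in the same fiber sits at another index, because it differs from the color of the
  -- chosen vertex.
  · refine Or.inl ⟨rfl, fun heq => hj (Fin.ext ?_)⟩
    rw [hC] at *
    have h := (e w).symm.injective heq
    rw [Subtype.mk.injEq] at h
    exact h.symm
  · exact Or.inr hvw

end Multicoloring

end SimpleGraph

theorem mainTheorem1 {V : Type*} [Finite V] (G : SimpleGraph V) (hG : G.IsP4Sparse)
    (ℓ : ℕ) (hℓ : 0 < ℓ) :
    (G.lexProduct (SimpleGraph.completeGraph (Fin ℓ))).IsBContinuous := by
  intro k hk hkb
  have hcol : ∀ m, k ≤ m → ∃ c, G.IsMulticoloring ℓ Set.univ (Finset.range m) c := by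
    intro m hm
    obtain ⟨C⟩ := (SimpleGraph.chromaticNumber_le_iff_colorable.1 hk).mono hm
    exact ⟨_, C.isMulticoloring_fiberColors⟩
  -- The descent starts at `χ_b`; `hcol` supplies the required multicoloring at each `m ≥ k`.
  refine Nat.decreasingInduction'
    (P := (G.lexProduct (SimpleGraph.completeGraph (Fin ℓ))).HasBColoring) ?_ hkb
    (SimpleGraph.isGreatest_bChromaticNumber _).1
  rintro m - hm ⟨C, hC⟩
  obtain ⟨c, hc⟩ := hG.extendsP4.descendsOn Set.univ (Finset.range (m + 1)) (Finset.range m)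
    (by simp) ⟨_, hC.isBMulticoloring_fiberColors⟩ (hcol m hm)
  exact hc.hasBColoring
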